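/- Let $L$ be a countable linear order, equipped with its order topology (the topology generated by the open rays $\{y : y<a\}$ and $\{y : a<y\}$, $a\in L$). By recursion on the ordinal $\alpha$, call $x\in L$ a left (resp. right) $\alpha$-limit if for every $\beta<\alpha$ the point $x$ is a limit from the left (resp. from the right) of $\beta$-limits, and call $x$ an $\alpha$-limit if it is a left or a right $\alpha$-limit. Here $x$ is a limit from the left of points of $S$ if $x$ is not the least element of $L$ and for every $a<x$ there is $y\in S$ with $a<y<x$, and symmetrically for the right; in particular every point is a $0$-limit. Define $\mathrm{RK}(x)\in\omega_1\cup\{\infty\}$ by $\mathrm{RK}(x)=\alpha$ if $\alpha+1$ is the least ordinal $\gamma$ such that $x$ is not a $\gamma$-limit, and $\mathrm{RK}(x)=\infty$ if $x$ is an $\alpha$-limit for all countable ordinals $\alpha$. Let $\mathrm{RK}(L)=\sup_{x\in L}\mathrm{RK}(x)$, taken in $\omega_1\cup\{\infty\}$. A space $X$ is strong Choquet if Player II has a winning strategy in the following game: in round $n$ Player I plays an open set $U_n$ and a point $x_n\in U_n$, with $U_n\subseteq V_{n-1}$ if $n\ge 1$, and Player II answers with an open set $V_n$ such that $x_n\in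 V_n\subseteq U_n$; Player II wins iff $\bigcap_n V_n\neq\emptyset$. For a partially ordered set $P$, a filter is a nonempty, upward closed, downward directed subset of $P$, and the maximal filter space $\mathrm{MF}(P)$ is the set of filters that are maximal under inclusion, with the topology generated by the sets $\{F\in \mathrm{MF}(P) : p\in F\}$, $p\in P$. Then the following are equivalent: 1. $\mathrm{RK}(L)<\infty$; 2. the order topology on $L$ is strong Choquet; 3. the order topology on $L$ is homeomorphic to $\mathrm{MF}(P)$ for some partially ordered set $P$; 4. the order topology on $L$ is homeomorphic to $\mathrm{MF}(P)$ for some countable partially ordered set $P$; 5. the order topology on $L$ is completely metrizable. -/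

import Mathlib

open Set TopologicalSpace

universe u v

/-! ### Limits in a linear order and the rank `RK` -/

section Rank

variable {L : Type u} [LinearOrder L]

/-- `x` is a limit from the left of points of `S`: `x` is not the least element and every
interval `(a, x)` contains a point of `S`. -/
def IsLimitFromLeft (S : Set L) (x : L) : Prop :=
  (∃ a, a < x) ∧ ∀ a, a < x → ∃ y ∈ S, a < y ∧ y < x

/-- `x` is a limit from the right of points of `S`: `x` is not the greatest element and every
interval `(x, b)` contains a point of `S`. -/
def IsLimitFromRight (S : Set L) (x : L) : Prop :=
  (∃ b, x < b) ∧ ∀ b, x < b → ∃ y ∈ S, x < y ∧ y < b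

/-- `x` is a (left or right) `α`-limit. It is a left `α`-limit if for every `β < α` it is a limit
from the left of `β`-limits, and a right `α`-limit if for every `β < α` it is a limit from the
right of `β`-limits. In particular every point is a `0`-limit. -/
def IsOrdLimit (α : Ordinal.{0}) (x : L) : Prop :=
  (∀ β, β < α → IsLimitFromLeft {y : L | IsOrdLimit β y} x) ∨
    (∀ β, β < α → IsLimitFromRight {y : L | IsOrdLimit β y} x)
termination_by α

/-- The countable ordinals, i.e. the ordinals below `ω₁`. -/
abbrev CountableOrdinal : Type 1 := Set.Iio (Ordinal.omega.{0} 1)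

instance : OrderBot CountableOrdinal where
  bot := ⟨0, Ordinal.omega_pos 1⟩
  bot_le a := bot_le (a := a.1)

/-- Suprema of bounded sets of countable ordinals, so that `WithTop CountableOrdinal`,
that is `ω₁ ∪ {∞}`, is a complete linear order. -/
noncomputable instance : ConditionallyCompleteLinearOrderBot CountableOrdinal :=
  WellFoundedLT.conditionallyCompleteLinearOrderBot CountableOrdinal

open Classical in
/-- The rank of a point, with values in `ω₁ ∪ {∞}`: it is `α` if `α + 1` is the least ordinal `γ`
such that `x` is not a `γ`-limit, and `∞` if there is no such countable `α`, that is, if `x` is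
an `α`-limit for all countable `α`. -/
noncomputable def pointRK (x : L) : WithTop CountableOrdinal :=
  if h : ∃ α : CountableOrdinal,
      IsLeast {γ : Ordinal.{0} | ¬ IsOrdLimit γ x} ((α : Ordinal.{0}) + 1) then
    ((h.choose : CountableOrdinal) : WithTop CountableOrdinal)
  else ⊤

/-- The rank of a linear order: the supremum, in `ω₁ ∪ {∞}`, of the ranks of its points. -/
noncomputable def orderRK (L : Type u) [LinearOrder L] : WithTop CountableOrdinal :=
  ⨆ x : L, pointRK x

end Rank

/-! ### The strong Choquet game -/

section Choquet

/-- A move of Player I in the strong Choquet game on `X`: an open set with a point of it. -/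
structure ChoquetMove (X : Type u) [TopologicalSpace X] where
  set : Opens X
  pt : X
  pt_mem : pt ∈ set

variable {X : Type u} [TopologicalSpace X]

/-- A strategy for Player II: a reply to every finite sequence `(U₀, x₀), …, (Uₙ, xₙ)` of moves
of Player I. (The earlier moves of Player II are determined by these and the strategy.) -/
abbrev ChoquetStrategy (X : Type u) [TopologicalSpace X] : Type u :=
  (n : ℕ) → (Fin (n + 1) → ChoquetMove X) → Opens X

/-- The reply `Vₙ` of Player II in round `n` when Player I plays `m 0, m 1, …` -/
def ChoquetStrategy.reply (σ : ChoquetStrategy X) (m : ℕ → ChoquetMove X) (n : ℕ) : Opens X :=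
  σ n (fun i => m i)

/-- `σ` is a winning strategy for Player II: as long as Player I has played by the rules
(`Uᵢ₊₁ ⊆ Vᵢ`), the reply is legal (`xₙ ∈ Vₙ ⊆ Uₙ`), and in every infinite play
the intersection of the sets `Vₙ` is nonempty. -/
def ChoquetStrategy.IsWinning (σ : ChoquetStrategy X) : Prop :=
  (∀ (m : ℕ → ChoquetMove X) (n : ℕ), (∀ i < n, (m (i + 1)).set ≤ σ.reply m i) →
    (m n).pt ∈ σ.reply m n ∧ σ.reply m n ≤ (m n).set) ∧
  (∀ m : ℕ → ChoquetMove X, (∀ i, (m (i + 1)).set ≤ σ.reply m i) →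
    (⋂ n, (σ.reply m n : Set X)).Nonempty)

/-- A space is strong Choquet if Player II has a winning strategy. -/
def IsStrongChoquet (X : Type u) [TopologicalSpace X] : Prop :=
  ∃ σ : ChoquetStrategy X, σ.IsWinning

end Choquet

/-! ### Maximal filter spaces -/

section MaximalFilter

/-- The set `MF(P)` of maximal filters on a partial order `P`, where a filter is a nonempty,
downward directed, upward closed subset. -/
def MaximalFilter (P : Type v) [PartialOrder P] : Type v :=
  {F : Order.PFilter P // IsMax F}

/-- The topology on `MF(P)` generated by the sets `{F | p ∈ F}` for `p : P`. -/
instance (P : Type v) [PartialOrder P] : TopologicalSpace (MaximalFilter P) :=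
  TopologicalSpace.generateFrom (Set.range fun p : P => {F : MaximalFilter P | p ∈ F.1})

/-- `X` is homeomorphic to the maximal filter space of some partial order. -/
def IsMaximalFilterSpace (X : Type u) [TopologicalSpace X] : Prop :=
  ∃ (P : Type v) (_ : PartialOrder P), Nonempty (X ≃ₜ MaximalFilter P)

/-- `X` is homeomorphic to the maximal filter space of some countable partial order. -/
def IsCountablyBasedMaximalFilterSpace (X : Type u) [TopologicalSpace X] : Prop :=
  ∃ (P : Type v) (_ : PartialOrder P), Countable P ∧ Nonempty (X ≃ₜ MaximalFilter P)

end MaximalFilter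

/-! The sets of `α`-limits are the Cantor–Bendixson derivatives of `L`. As `L` is countable, they
stabilize at a countable stage, so `RK(L) < ∞` says that `L` is scattered. A scattered `L` is
countable and metrizable, and its rank function exhibits it as a `Gδ` in its completion, hence
Polish. A Polish space is the space of maximal filters of formal balls, and any `MF(P)` is strong
Choquet because a descending sequence in `P` extends to a maximal filter. Conversely, in a nonempty
dense-in-itself subset of a countable `T₁` space Player I can discard the points of the space one by
one; so strong Choquet forces `L` to be scattered. -/

open Filter Topology

/-! ### Limits as Cantor–Bendixson derivatives -/

section AccumulationPoints

variable {L : Type u} [LinearOrder L]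

/-- `x` is an accumulation point of `S` iff it is a limit of points of `S` from one side. -/
theorem accPt_iff_isLimitFrom [TopologicalSpace L] [OrderTopology L] {S : Set L} {x : L} :
    AccPt x (𝓟 S) ↔ IsLimitFromLeft S x ∨ IsLimitFromRight S x := by
  rw [accPt_iff_frequently_nhdsNE, ← nhdsLT_sup_nhdsGT, frequently_sup]
  refine or_congr ?_ ?_
  · by_cases h : ∃ a, a < x
    · rw [(nhdsLT_basis_of_exists_lt h).frequently_iff]
      exact ⟨fun H => ⟨h, fun a ha => let ⟨y, hy, hS⟩ := H a ha; ⟨y, hS, hy.1, hy.2⟩⟩,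
        fun H a ha => let ⟨y, hS, hy⟩ := H.2 a ha; ⟨y, hy, hS⟩⟩
    · have : Iio x = ∅ := eq_empty_iff_forall_notMem.2 fun a ha => h ⟨a, ha⟩
      simp [IsLimitFromLeft, h, this]
  · by_cases h : ∃ a, x < a
    · rw [(nhdsGT_basis_of_exists_gt h).frequently_iff]
      exact ⟨fun H => ⟨h, fun a ha => let ⟨y, hy, hS⟩ := H a ha; ⟨y, hS, hy.1, hy.2⟩⟩,
        fun H a ha => let ⟨y, hS, hy⟩ := H.2 a ha; ⟨y, hy, hS⟩⟩
    · have : Ioi x = ∅ := eq_empty_iff_forall_notMem.2 fun a ha => h ⟨a, ha⟩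
      simp [IsLimitFromRight, h, this]

theorem IsLimitFromLeft.mono {S T : Set L} {x : L} (h : IsLimitFromLeft S x) (hST : S ⊆ T) :
    IsLimitFromLeft T x :=
  ⟨h.1, fun a ha => let ⟨y, hy, h'⟩ := h.2 a ha; ⟨y, hST hy, h'⟩⟩

theorem IsLimitFromRight.mono {S T : Set L} {x : L} (h : IsLimitFromRight S x) (hST : S ⊆ T) :
    IsLimitFromRight T x :=
  ⟨h.1, fun a ha => let ⟨y, hy, h'⟩ := h.2 a ha; ⟨y, hST hy, h'⟩⟩

theorem IsOrdLimit.anti {α β : Ordinal.{0}} {x : L} (h : IsOrdLimit α x) (hβ : β ≤ α) :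
    IsOrdLimit β x := by
  rw [IsOrdLimit] at h ⊢
  exact h.imp (fun H γ hγ => H γ (hγ.trans_le hβ)) fun H γ hγ => H γ (hγ.trans_le hβ)

/-- The `α`-limits form the `α`-th Cantor–Bendixson derivative. -/
theorem isOrdLimit_iff_accPt [TopologicalSpace L] [OrderTopology L] {α : Ordinal.{0}} {x : L} :
    IsOrdLimit α x ↔ ∀ β < α, AccPt x (𝓟 {y : L | IsOrdLimit β y}) := by
  simp only [accPt_iff_isLimitFrom]
  constructor
  · intro h β hβ
    rw [IsOrdLimit] at h
    exact h.imp (· β hβ) (· β hβ)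
  · intro h
    rw [IsOrdLimit]
    by_contra! hc
    obtain ⟨⟨β, hβ, hl⟩, γ, hγ, hr⟩ := hc
    -- The side may depend on the stage, but derivatives decrease: an accumulation at stage `max β
    -- γ`, from whichever side, contradicts one of the two failures.
    rcases h (max β γ) (max_lt hβ hγ) with h | h
    · exact hl (h.mono fun y hy => IsOrdLimit.anti hy (le_max_left _ _))
    · exact hr (h.mono fun y hy => IsOrdLimit.anti hy (le_max_right _ _))

/-- Failure at `δ` is already caused by a single `β < δ`, so the first failure occurs at a
successor, as the definition of `RK` presupposes. -/
theorem exists_isLeast_not_isOrdLimit {α : Ordinal.{0}} {x : L} (h : ¬ IsOrdLimit α x) :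
    ∃ γ, γ < α ∧ IsLeast {γ : Ordinal.{0} | ¬ IsOrdLimit γ x} (γ + 1) := by
  let _ : TopologicalSpace L := Preorder.topology L
  have : OrderTopology L := ⟨rfl⟩
  obtain ⟨δ, hδ, hmin⟩ :=
    WellFounded.has_min (wellFounded_lt (α := Ordinal.{0})) {γ | ¬ IsOrdLimit γ x} ⟨α, h⟩
  obtain ⟨β, hβ⟩ := not_forall.1 (mt isOrdLimit_iff_accPt.2 hδ)
  obtain ⟨hβ, hacc⟩ := Classical.not_imp.1 hβ
  have hβ1 : ¬ IsOrdLimit (β + 1) x := fun H =>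
    hacc (isOrdLimit_iff_accPt.1 H β (Order.lt_add_one_iff.2 le_rfl))
  refine ⟨β, hβ.trans_le (not_lt.1 (hmin α h)), hβ1, fun γ hγ => ?_⟩
  exact (Order.add_one_le_of_lt hβ).trans (not_lt.1 (hmin γ hγ))

theorem pointRK_lt_top_iff {x : L} :
    pointRK x < ⊤ ↔ ∃ α : CountableOrdinal, ¬ IsOrdLimit (α : Ordinal.{0}) x := by
  rw [pointRK]
  split_ifs with h
  · refine iff_of_true (WithTop.coe_lt_top _) ?_
    obtain ⟨α, hα⟩ := h
    exact ⟨⟨α + 1, (Cardinal.isSuccLimit_omega 1).succ_lt α.2⟩, hα.1⟩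
  · refine iff_of_false (lt_irrefl _) fun ⟨α, hα⟩ => h ?_
    obtain ⟨γ, hγ, hl⟩ := exists_isLeast_not_isOrdLimit hα
    exact ⟨⟨γ, hγ.trans α.2⟩, hl⟩

theorem bddAbove_range_countableOrdinal {ι : Type u} [Countable ι] (f : ι → CountableOrdinal) :
    BddAbove (range f) := by
  have hb : BddAbove (range fun i => (f i : Ordinal.{0})) :=
    ⟨Ordinal.omega 1, by rintro _ ⟨i, rfl⟩; exact (f i).2.le⟩
  exact ⟨⟨⨆ i, (f i : Ordinal.{0}), Ordinal.iSup_lt_omega_one fun i => (f i).2⟩, by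
    rintro _ ⟨i, rfl⟩; exact le_ciSup hb i⟩

theorem orderRK_lt_top_iff [Countable L] :
    orderRK L < ⊤ ↔ ∀ x : L, ∃ α : CountableOrdinal, ¬ IsOrdLimit (α : Ordinal.{0}) x := by
  simp only [← pointRK_lt_top_iff]
  refine ⟨fun h x => (le_iSup (fun x : L => pointRK x) x).trans_lt h, fun h => ?_⟩
  lift pointRK (L := L) to L → CountableOrdinal using fun x => (h x).ne with f hf
  obtain ⟨b, hb⟩ := bddAbove_range_countableOrdinal f
  refine lt_of_le_of_lt (b := (b : WithTop CountableOrdinal)) ?_ (WithTop.coe_lt_top b)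
  refine iSup_le fun x => ?_
  rw [← congrFun hf x]
  exact WithTop.coe_le_coe.2 (hb ⟨x, rfl⟩)

/-- A countable linear order without nonempty dense-in-itself subsets has rank below `∞`. -/
theorem orderRK_lt_top_of_preperfect [Countable L] [TopologicalSpace L] [OrderTopology L]
    (h : ∀ K : Set L, Preperfect K → K = ∅) : orderRK L < ⊤ := by
  rw [orderRK_lt_top_iff]
  set K : Set L := {x | ∀ α : CountableOrdinal, IsOrdLimit (α : Ordinal.{0}) x} with hK
  -- Each point outside `K` fails at some countable stage; the supremum `b` of these countably many
  -- stages is still countable.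
  have hstep : ∃ b : CountableOrdinal, {x : L | IsOrdLimit (b : Ordinal.{0}) x} ⊆ K := by
    choose f hf using fun x : ↥(Kᶜ) => not_forall.1 x.2
    obtain ⟨b, hb⟩ := bddAbove_range_countableOrdinal f
    refine ⟨b, fun x hx => ?_⟩
    by_contra hxK
    exact hf ⟨x, hxK⟩ (IsOrdLimit.anti hx (hb ⟨⟨x, hxK⟩, rfl⟩))
  obtain ⟨b, hb⟩ := hstep
  have hperf : Preperfect K := fun x hx =>
    (isOrdLimit_iff_accPt.1 (hx ⟨b + 1, (Cardinal.isSuccLimit_omega 1).succ_lt b.2⟩) b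
      (Order.lt_add_one_iff.2 le_rfl)).mono (principal_mono.2 hb)
  intro x
  by_contra! hx
  exact (h K hperf ▸ (show x ∈ K from hx) : x ∈ (∅ : Set L))

/-- If every point has a rank, then some ordinal-valued function isolates every point among the
points at which its value is at least as large. -/
theorem exists_rank_not_accPt [TopologicalSpace L] [OrderTopology L]
    (h : ∀ x : L, ∃ α : Ordinal.{0}, ¬ IsOrdLimit α x) :
    ∃ r : L → Ordinal.{0}, ∀ x, ¬ AccPt x (𝓟 {y | r x ≤ r y}) := by
  choose f hf using h
  choose r _ hr using fun x => exists_isLeast_not_isOrdLimit (hf x)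
  refine ⟨r, fun x hx => (hr x).1 (isOrdLimit_iff_accPt.2 fun β hβ => hx.mono ?_)⟩
  refine principal_mono.2 fun y (hy : r x ≤ r y) => ?_
  by_contra hc
  have h1 : r y + 1 ≤ β := (hr y).2 hc
  exact absurd (hy.trans_lt ((Order.lt_add_one_iff.2 le_rfl).trans_le h1))
    (not_lt.2 (Order.lt_add_one_iff.1 hβ))

end AccumulationPoints

/-! ### Scattered countable spaces are Polish -/

section CompletelyMetrizable

/-- A space that embeds as a `Gδ` set into a Polish space is Polish. -/
theorem Topology.IsEmbedding.polishSpace_of_isGδ {X : Type*} {Y : Type*} [TopologicalSpace X]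
    [TopologicalSpace Y] [PolishSpace Y] {e : X → Y} (he : IsEmbedding e)
    (hG : IsGδ (range e)) : PolishSpace X := by
  obtain ⟨f, hf, hrange⟩ := hG.eq_iInter_nat
  have hmem : ∀ x n, e x ∈ f n := fun x => by
    have := mem_range_self (f := e) x
    rw [hrange] at this
    exact mem_iInter.1 this
  have : ∀ n, PolishSpace (f n) := fun n => (hf n).polishSpace
  -- The diagonal embedding into the product of the open sets: its range consists of the constant
  -- sequences, a closed condition.
  let g : X → ∀ n, f n := fun x n => ⟨e x, hmem x n⟩
  have hg : Continuous g := continuous_pi fun n => he.continuous.subtype_mk _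
  have hcomp : IsEmbedding ((fun y : ∀ n, f n => (y 0 : Y)) ∘ g) := he
  have hge : IsEmbedding g :=
    IsEmbedding.of_comp hg (continuous_subtype_val.comp (continuous_apply 0)) hcomp
  have hcl : IsClosed (range g) := by
    have : range g = ⋂ n, {y : ∀ n, f n | (y n : Y) = y 0} := by
      ext y
      simp only [mem_range, mem_iInter, mem_ofPred_eq]
      refine ⟨fun ⟨x, hx⟩ n => by rw [← hx], fun hy => ?_⟩
      have : (y 0 : Y) ∈ range e := by
        rw [hrange]
        exact mem_iInter.2 fun n => hy n ▸ (y n).2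
      obtain ⟨x, hx⟩ := this
      exact ⟨x, funext fun n => Subtype.ext (hx.trans (hy n).symm)⟩
    rw [this]
    exact isClosed_iInter fun n => isClosed_eq
      (continuous_subtype_val.comp (continuous_apply n))
      (continuous_subtype_val.comp (continuous_apply 0))
  exact (IsClosedEmbedding.mk hge hcl).polishSpace

/-- A countable space embedded into a metrizable space is a `Gδ` set there if it is scattered,
as witnessed by an ordinal-valued function. -/
theorem Topology.IsEmbedding.isGδ_range_of_rank {X : Type*} {Y : Type*} [Countable X]
    [TopologicalSpace X] [TopologicalSpace Y] [MetrizableSpace Y] {e : X → Y}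
    (he : IsEmbedding e) (r : X → Ordinal.{0}) (hr : ∀ x, ¬ AccPt x (𝓟 {y | r x ≤ r y})) :
    IsGδ (range e) := by
  have hW : ∀ x, ∃ W : Set Y, IsOpen W ∧ e x ∈ W ∧ ∀ y, e y ∈ W → r x ≤ r y → y = x := by
    intro x
    have := hr x
    rw [accPt_iff_nhds] at this
    push Not at this
    obtain ⟨U, hU, hUx⟩ := this
    rw [he.nhds_eq_comap, mem_comap] at hU
    obtain ⟨V, hV, hVU⟩ := hU
    obtain ⟨W, hWV, hW, hxW⟩ := mem_nhds_iff.1 hV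
    exact ⟨W, hW, hxW, fun y hy hxy => hUx y ⟨hVU (hWV hy), hxy⟩⟩
  choose W hWo hWx hWr using hW
  obtain ⟨enc, henc⟩ := exists_injective_nat X
  let key : X → Ordinal.{0} ×ₗ ℕ := fun x => toLex (r x, enc x)
  -- If `e y ∈ W x` and `y ≠ x`, then `r y < r x`, so `e y` meets the condition for `x` through `W
  -- y`. Conversely, for the `x` of least key with `z ∈ W x`, the condition leaves only `z = e x`.
  have hkey : range e = (⋃ x, W x) ∩ ⋂ x, ((W x)ᶜ ∪ (⋃ y ∈ {y | key y < key x}, W y) ∪ {e x}) := by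
    ext z
    constructor
    · rintro ⟨y, rfl⟩
      refine ⟨mem_iUnion.2 ⟨y, hWx y⟩, mem_iInter.2 fun x => ?_⟩
      by_cases hyx : y = x
      · exact Or.inr (hyx ▸ rfl)
      by_cases hyW : e y ∈ W x
      · refine Or.inl (Or.inr (mem_biUnion (x := y) ?_ (hWx y)))
        exact Prod.Lex.toLex_lt_toLex.2 (Or.inl (not_le.1 fun h => hyx (hWr x y hyW h)))
      · exact Or.inl (Or.inl hyW)
    · rintro ⟨hz, hz'⟩
      obtain ⟨x₀, hx₀⟩ := mem_iUnion.1 hz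
      obtain ⟨x, hx, hmin⟩ := WellFounded.has_min
        (InvImage.wf key (wellFounded_lt (α := Ordinal.{0} ×ₗ ℕ))) {x | z ∈ W x} ⟨x₀, hx₀⟩
      rcases mem_iInter.1 hz' x with (h | h) | h
      · exact absurd hx h
      · obtain ⟨y, hy, hzy⟩ := mem_iUnion₂.1 h
        exact absurd hy (hmin y hzy)
      · exact ⟨x, h.symm⟩
  let _ := metrizableSpaceMetric Y
  rw [hkey]
  refine (isOpen_iUnion hWo).isGδ.inter (IsGδ.iInter fun x => ?_)
  exact ((hWo x).isClosed_compl.isGδ.union (isOpen_biUnion fun y _ => hWo y).isGδ).union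
    isClosed_singleton.isGδ

theorem secondCountableTopology_of_countable_order (L : Type*) [LinearOrder L] [Countable L]
    [TopologicalSpace L] [OrderTopology L] : SecondCountableTopology L := by
  refine ⟨⟨range Ioi ∪ range Iio, (countable_range _).union (countable_range _), ?_⟩⟩
  refine (OrderTopology.topology_eq_generate_intervals (α := L)).trans (congrArg generateFrom ?_)
  ext s
  constructor
  · rintro ⟨a, rfl | rfl⟩
    exacts [Or.inl ⟨a, rfl⟩, Or.inr ⟨a, rfl⟩]
  · rintro (⟨a, rfl⟩ | ⟨a, rfl⟩)
    exacts [⟨a, Or.inl rfl⟩, ⟨a, Or.inr rfl⟩]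

theorem isCompletelyMetrizableSpace_of_orderRK_lt_top (L : Type*) [LinearOrder L] [Countable L]
    [TopologicalSpace L] [OrderTopology L] (h : orderRK L < ⊤) :
    IsCompletelyMetrizableSpace L := by
  have := secondCountableTopology_of_countable_order L
  obtain ⟨r, hr⟩ := exists_rank_not_accPt fun x : L =>
    let ⟨α, hα⟩ := orderRK_lt_top_iff.1 h x; ⟨α, hα⟩
  let _ := metrizableSpaceMetric L
  have he : IsEmbedding ((↑) : L → UniformSpace.Completion L) :=
    (UniformSpace.Completion.isUniformEmbedding_coe L).isEmbedding
  have := he.polishSpace_of_isGδ (he.isGδ_range_of_rank r hr)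
  infer_instance

end CompletelyMetrizable

/-! ### Playing the strong Choquet game -/

section Strategies

variable {X : Type u} [TopologicalSpace X]

/-- A sequence defined from all its earlier terms. -/
noncomputable def historySeq {M : Type u} (next : (n : ℕ) → (Fin n → M) → M) (n : ℕ) : M :=
  next n fun i => historySeq next i
termination_by n
decreasing_by exact i.2

theorem historySeq_eq {M : Type u} (next : (n : ℕ) → (Fin n → M) → M) (n : ℕ) :
    historySeq next n = next n fun i => historySeq next i := by
  rw [historySeq]

/-- In a countable strong Choquet `T₁` space there are no nonempty dense-in-itself subsets:
Player I can play points of such a set and avoid all points of the space one after another. -/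
theorem IsStrongChoquet.eq_empty_of_preperfect [Countable X] [T1Space X] (h : IsStrongChoquet X)
    {K : Set X} (hK : Preperfect K) : K = ∅ := by
  obtain ⟨σ, hleg, hwin⟩ := h
  by_contra hne
  obtain ⟨x₀, hx₀⟩ := nonempty_iff_ne_empty.2 hne
  have : Nonempty X := ⟨x₀⟩
  obtain ⟨q, hq⟩ := exists_surjective_nat X
  have hmove : ∀ (V : Opens X) (z x : X), x ∈ V → x ∈ K →
      ∃ m : ChoquetMove X, m.set ≤ V ∧ m.pt ∈ K ∧ z ∉ m.set := by
    intro V z x hxV hxK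
    obtain ⟨y, hy, hyz⟩ : ∃ y ∈ (V : Set X) ∩ K, y ≠ z := by
      by_cases hxz : x = z
      · obtain ⟨y, hy, hyx⟩ := accPt_iff_nhds.1 (hK x hxK) V (V.isOpen.mem_nhds hxV)
        exact ⟨y, hy, hxz ▸ hyx⟩
      · exact ⟨x, ⟨hxV, hxK⟩, hxz⟩
    exact ⟨⟨⟨(V : Set X) ∩ {z}ᶜ, V.isOpen.inter isOpen_compl_singleton⟩, y, hy.1, hyz⟩,
      fun _ hw => hw.1, hy.2, fun hw => hw.2 rfl⟩
  classical
  -- Round `k + 1` removes the point `q k`. The final default move is never used, since `hinv` keeps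
  -- the current point in `K` and `hmove` then supplies a move.
  let next : (n : ℕ) → (Fin n → ChoquetMove X) → ChoquetMove X := fun
    | 0 => fun _ => ⟨⊤, x₀, trivial⟩
    | k + 1 => fun hist =>
      if H : ∃ m : ChoquetMove X, m.set ≤ σ k hist ∧ m.pt ∈ K ∧ q k ∉ m.set then H.choose
      else ⟨⊤, x₀, trivial⟩
  let m := historySeq next
  have hm0 : m 0 = ⟨⊤, x₀, trivial⟩ := historySeq_eq next 0
  have hms : ∀ n, (∃ m' : ChoquetMove X, m'.set ≤ σ.reply m n ∧ m'.pt ∈ K ∧ q n ∉ m'.set) →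
      (m (n + 1)).set ≤ σ.reply m n ∧ (m (n + 1)).pt ∈ K ∧ q n ∉ (m (n + 1)).set := by
    intro n H
    have : m (n + 1) = H.choose := (historySeq_eq next (n + 1)).trans (dif_pos H)
    rw [this]
    exact H.choose_spec
  have hinv : ∀ n, (m n).pt ∈ K ∧ ∀ i < n,
      (m (i + 1)).set ≤ σ.reply m i ∧ q i ∉ (m (i + 1)).set := by
    intro n
    induction n with
    | zero => exact ⟨hm0 ▸ hx₀, fun i hi => absurd hi (Nat.not_lt_zero i)⟩
    | succ n ih =>
      have hpt := (hleg m n fun i hi => (ih.2 i hi).1).1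
      obtain ⟨h1, h2, h3⟩ := hms n (hmove _ (q n) _ hpt ih.1)
      refine ⟨h2, fun i hi => ?_⟩
      rcases Nat.lt_succ_iff_lt_or_eq.1 hi with hi | rfl
      exacts [ih.2 i hi, ⟨h1, h3⟩]
  have hall : ∀ i, (m (i + 1)).set ≤ σ.reply m i := fun i => ((hinv (i + 1)).2 i i.lt_succ_self).1
  obtain ⟨z, hz⟩ := hwin m hall
  obtain ⟨n, rfl⟩ := hq z
  have h1 : q n ∈ σ.reply m (n + 1) := mem_iInter.1 hz (n + 1)
  exact ((hinv (n + 1)).2 n n.lt_succ_self).2 ((hleg m (n + 1) fun i _ => hall i).2 h1)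

/-- The strategy of a player who keeps a state in `S`, updates it by `step` after each move of
the opponent and answers with the open set that the state determines. -/
def ChoquetStrategy.ofStep {S : Type v} (s₀ : S) (step : S → ChoquetMove X → S)
    (V : S → Opens X) : ChoquetStrategy X :=
  fun _ m => V ((List.ofFn m).foldl step s₀)

/-- The state before round `n` when the opponent plays `m`. -/
def choquetState {S : Type v} (s₀ : S) (step : S → ChoquetMove X → S) (m : ℕ → ChoquetMove X) :
    ℕ → S
  | 0 => s₀
  | n + 1 => step (choquetState s₀ step m n) (m n)

theorem ChoquetStrategy.reply_ofStep {S : Type v} (s₀ : S) (step : S → ChoquetMove X → S)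
    (V : S → Opens X) (m : ℕ → ChoquetMove X) (n : ℕ) :
    (ChoquetStrategy.ofStep s₀ step V).reply m n = V (choquetState s₀ step m (n + 1)) := by
  have key : ∀ k : ℕ, (List.ofFn fun i : Fin k => m i).foldl step s₀ =
      choquetState s₀ step m k := by
    intro k
    induction k with
    | zero => simp [choquetState]
    | succ k ih =>
      rw [List.ofFn_succ', List.concat_eq_append, List.foldl_append]
      simp only [Fin.val_castSucc, Fin.val_last, ih, List.foldl_cons, List.foldl_nil, choquetState]
  exact congrArg V (key (n + 1))

end Strategies

/-! ### Maximal filter spaces are strong Choquet -/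

section MaximalFilterSpaces

variable {P : Type v} [PartialOrder P]

theorem Order.PFilter.exists_le_isMax (F : Order.PFilter P) : ∃ G, F ≤ G ∧ IsMax G := by
  refine zorn_le_nonempty_Ici₀ F (fun c _ hc G hG => ?_) F le_rfl
  refine ⟨(Order.IsPFilter.of_def (F := {p | ∃ H ∈ c, p ∈ H}) ?_ ?_ ?_).toPFilter, ?_⟩
  · obtain ⟨p, hp⟩ := G.nonempty
    exact ⟨p, G, hG, hp⟩
  · rintro p ⟨H, hH, hp⟩ q ⟨H', hH', hq⟩
    obtain ⟨I, hI, hpI, hqI⟩ : ∃ I ∈ c, p ∈ I ∧ q ∈ I := by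
      rcases hc.total hH hH' with h | h
      exacts [⟨H', hH', h hp, hq⟩, ⟨H, hH, hp, h hq⟩]
    obtain ⟨s, hs, hsp, hsq⟩ := I.directed p hpI q hqI
    exact ⟨s, ⟨I, hI, hs⟩, hsp, hsq⟩
  · rintro p q hpq ⟨H, hH, hp⟩
    exact ⟨H, hH, H.mem_of_le hpq hp⟩
  · exact fun H hH p hp => ⟨H, hH, hp⟩

namespace MaximalFilter

/-- The basic open set of maximal filters containing `p`. -/
def basicOpen (p : P) : Opens (MaximalFilter P) :=
  ⟨{F | p ∈ F.1}, isOpen_generateFrom_of_mem ⟨p, rfl⟩⟩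

theorem basicOpen_mono {p q : P} (h : p ≤ q) : basicOpen p ≤ basicOpen q :=
  fun F hF => F.1.mem_of_le h hF

/-- Directedness of filters makes the generating sets a basis: a common lower bound in `F` takes
care of intersections. -/
theorem exists_basicOpen_le {U : Set (MaximalFilter P)} (hU : IsOpen U) {F : MaximalFilter P}
    (hF : F ∈ U) : ∃ p ∈ F.1, (basicOpen p : Set (MaximalFilter P)) ⊆ U := by
  induction hU with
  | basic s hs =>
    obtain ⟨p, rfl⟩ := hs
    exact ⟨p, hF, subset_rfl⟩
  | univ =>
    obtain ⟨p, hp⟩ := F.1.nonempty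
    exact ⟨p, hp, subset_univ _⟩
  | inter s t _ _ ihs iht =>
    obtain ⟨p, hp, hps⟩ := ihs hF.1
    obtain ⟨q, hq, hqt⟩ := iht hF.2
    obtain ⟨r, hr, hrp, hrq⟩ := F.1.directed p hp q hq
    exact ⟨r, hr, subset_inter (fun _ h => hps (basicOpen_mono hrp h))
      fun _ h => hqt (basicOpen_mono hrq h)⟩
  | sUnion S _ ih =>
    obtain ⟨s, hs, hFs⟩ := hF
    obtain ⟨p, hp, hps⟩ := ih s hs hFs
    exact ⟨p, hp, hps.trans (subset_sUnion_of_mem hs)⟩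

/-- A descending sequence is contained in a maximal filter. -/
theorem exists_forall_mem_of_antitone {p : ℕ → P} (hp : Antitone p) :
    ∃ F : MaximalFilter P, ∀ n, p n ∈ F.1 := by
  have hF : Order.IsPFilter {q | ∃ n, p n ≤ q} := by
    refine Order.IsPFilter.of_def ⟨p 0, 0, le_rfl⟩ ?_ ?_
    · rintro a ⟨i, hi⟩ b ⟨j, hj⟩
      exact ⟨p (max i j), ⟨_, le_rfl⟩, (hp (le_max_left i j)).trans hi,
        (hp (le_max_right i j)).trans hj⟩
    · rintro a b hab ⟨i, hi⟩
      exact ⟨i, hi.trans hab⟩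
  obtain ⟨G, hG, hmax⟩ := hF.toPFilter.exists_le_isMax
  exact ⟨⟨G, hmax⟩, fun n => hG ⟨n, le_rfl⟩⟩

variable (P) in
/-- Maximal filter spaces are strong Choquet: Player II answers with basic open sets given by a
descending sequence in `P`. -/
theorem isStrongChoquet : IsStrongChoquet (MaximalFilter P) := by
  classical
  -- The state `s` is the element of `P` chosen last; `none` is the initial state and the default
  -- when no good element exists.
  let Good (s : Option P) (m : ChoquetMove (MaximalFilter P)) (p : P) : Prop :=
    p ∈ m.pt.1 ∧ basicOpen p ≤ m.set ∧ ∀ q ∈ s, p ≤ q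
  let step (s : Option P) (m : ChoquetMove (MaximalFilter P)) : Option P :=
    if H : ∃ p, Good s m p then some H.choose else none
  let V (s : Option P) : Opens (MaximalFilter P) := s.elim ⊤ basicOpen
  have hstep : ∀ s m, m.set ≤ V s → ∃ p, step s m = some p ∧ Good s m p := by
    intro s m hm
    have H : ∃ p, Good s m p := by
      obtain ⟨p, hp, hpm⟩ := exists_basicOpen_le m.set.isOpen m.pt_mem
      cases s with
      | none => exact ⟨p, hp, hpm, by simp⟩
      | some q =>
        obtain ⟨r, hr, hrp, hrq⟩ := m.pt.1.directed p hp q (hm m.pt_mem)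
        refine ⟨r, hr, (basicOpen_mono hrp).trans hpm, ?_⟩
        rintro _ ⟨rfl⟩
        exact hrq
    exact ⟨H.choose, dif_pos H, H.choose_spec⟩
  have hgood : ∀ (m : ℕ → ChoquetMove (MaximalFilter P)) (n : ℕ),
      (∀ i < n, (m (i + 1)).set ≤ (ChoquetStrategy.ofStep none step V).reply m i) →
      ∃ p, choquetState none step m (n + 1) = some p ∧ Good (choquetState none step m n) (m n) p := by
    intro m n hn
    refine hstep _ _ ?_
    cases n with
    | zero => exact le_top
    | succ n => exact ChoquetStrategy.reply_ofStep none step V m n ▸ hn n n.lt_succ_self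
  refine ⟨.ofStep none step V, fun m n hn => ?_, fun m hm => ?_⟩
  · obtain ⟨p, hp, hgp⟩ := hgood m n hn
    rw [ChoquetStrategy.reply_ofStep, hp]
    exact ⟨hgp.1, hgp.2.1⟩
  · choose p hp hgp using fun n => hgood m n fun i _ => hm i
    have hanti : Antitone p := antitone_nat_of_succ_le fun n => (hgp (n + 1)).2.2 _ (hp n)
    obtain ⟨F, hF⟩ := exists_forall_mem_of_antitone hanti
    refine ⟨F, mem_iInter.2 fun n => ?_⟩
    rw [ChoquetStrategy.reply_ofStep, hp]
    exact hF n

end MaximalFilter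

/-- Being strong Choquet passes along homeomorphisms. -/
theorem IsStrongChoquet.of_homeomorph {X : Type u} {Y : Type v} [TopologicalSpace X]
    [TopologicalSpace Y] (h : IsStrongChoquet Y) (e : X ≃ₜ Y) : IsStrongChoquet X := by
  obtain ⟨σ, hleg, hwin⟩ := h
  let f (m : ChoquetMove X) : ChoquetMove Y :=
    ⟨m.set.comap ⟨e.symm, e.symm.continuous⟩, e m.pt, by
      change e.symm (e m.pt) ∈ m.set
      rw [e.symm_apply_apply]
      exact m.pt_mem⟩
  let τ : ChoquetStrategy X := fun n m => (σ n fun i => f (m i)).comap ⟨e, e.continuous⟩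
  have hτ : ∀ m : ℕ → ChoquetMove X, ∀ n, ∀ x, x ∈ τ.reply m n ↔ e x ∈ σ.reply (f ∘ m) n :=
    fun _ _ _ => Iff.rfl
  have hle : ∀ m : ℕ → ChoquetMove X, ∀ i, (m (i + 1)).set ≤ τ.reply m i →
      ((f ∘ m) (i + 1)).set ≤ σ.reply (f ∘ m) i := by
    intro m i h y hy
    have := (hτ m i _).1 (h hy)
    rwa [show e ((⟨e.symm, e.symm.continuous⟩ : C(Y, X)) y) = y from e.apply_symm_apply y] at this
  refine ⟨τ, fun m n hn => ?_, fun m hm => ?_⟩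
  · obtain ⟨h1, h2⟩ := hleg (f ∘ m) n fun i hi => hle m i (hn i hi)
    refine ⟨h1, fun x hx => ?_⟩
    have : e.symm (e x) ∈ (m n).set := h2 hx
    rwa [e.symm_apply_apply] at this
  · obtain ⟨y, hy⟩ := hwin (f ∘ m) fun i => hle m i (hm i)
    refine ⟨e.symm y, mem_iInter.2 fun n => (hτ m n _).2 ?_⟩
    rw [e.apply_symm_apply]
    exact mem_iInter.1 hy n

end MaximalFilterSpaces

/-! ### Polish spaces as spaces of formal balls -/

section FormalBalls

/-- Formal balls: a ball with centre `c i` and radius `1 / (n + 1)`, for each index `i`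
and each `n`. -/
structure FormalBall {X : Type u} {ι : Type v} (c : ι → X) : Type v where
  idx : ι
  lvl : ℕ

namespace FormalBall

variable {X : Type u} {ι : Type v} {c : ι → X}

instance [Countable ι] : Countable (FormalBall c) :=
  Function.Injective.countable (f := fun p : FormalBall c => (p.idx, p.lvl)) fun p q h => by
    cases p; cases q; simpa using h

def center (p : FormalBall c) : X := c p.idx

noncomputable def radius (p : FormalBall c) : ℝ := 1 / ((p.lvl : ℝ) + 1)

theorem radius_pos (p : FormalBall c) : 0 < p.radius := Nat.one_div_pos_of_nat

variable [MetricSpace X]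

noncomputable def ball (p : FormalBall c) : Set X := Metric.ball p.center p.radius

/-- `p` is formally strictly inside `q`. -/
def Inside (p q : FormalBall c) : Prop := dist p.center q.center + p.radius < q.radius

theorem Inside.trans {p q r : FormalBall c} (h : p.Inside q) (h' : q.Inside r) : p.Inside r := by
  have := dist_triangle p.center q.center r.center
  unfold Inside at *
  linarith

theorem Inside.radius_lt {p q : FormalBall c} (h : p.Inside q) : p.radius < q.radius := by
  have : 0 ≤ dist p.center q.center := dist_nonneg
  unfold Inside at h
  linarith

/-- Strictness off the diagonal gives antisymmetry through the radii, and places the closed ball of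
a smaller element inside the open ball of a larger one. -/
instance : PartialOrder (FormalBall c) where
  le p q := p = q ∨ p.Inside q
  le_refl p := Or.inl rfl
  le_trans := by
    rintro p q r (rfl | h) (rfl | h')
    exacts [Or.inl rfl, Or.inr h', Or.inr h, Or.inr (h.trans h')]
  le_antisymm := by
    rintro p q (rfl | h) (h' | h')
    exacts [rfl, rfl, h'.symm, absurd (h.trans h').radius_lt (lt_irrefl _)]

theorem le_iff {p q : FormalBall c} : p ≤ q ↔ p = q ∨ p.Inside q := Iff.rfl

theorem mem_ball {p : FormalBall c} {x : X} : x ∈ p.ball ↔ dist x p.center < p.radius := Iff.rfl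

theorem Inside.mem_ball {p q : FormalBall c} (h : p.Inside q) {x : X}
    (hx : dist x p.center ≤ p.radius) : x ∈ q.ball := by
  have := dist_triangle x p.center q.center
  rw [FormalBall.mem_ball]
  unfold Inside at h
  linarith

theorem ball_mono {p q : FormalBall c} (h : p ≤ q) : p.ball ⊆ q.ball := by
  rcases le_iff.1 h with rfl | h
  exacts [subset_rfl, fun x hx => h.mem_ball (FormalBall.mem_ball.1 hx).le]

/-- A radius below `ε / 2` suffices, since the centre is within one radius of `x`. With `y` a centre
and `s` its radius this yields `Inside`; with `y = x` and `s = ε` it yields small neighbourhoods. -/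
theorem exists_inside (hc : DenseRange c) (x : X) {ε : ℝ} (hε : 0 < ε) :
    ∃ r : FormalBall c, x ∈ r.ball ∧
      ∀ y s, dist x y + ε ≤ s → dist r.center y + r.radius < s := by
  obtain ⟨n, hn⟩ := exists_nat_one_div_lt (half_pos hε)
  obtain ⟨i, hi⟩ := hc.exists_dist_lt x (ε := 1 / ((n : ℝ) + 1)) Nat.one_div_pos_of_nat
  refine ⟨⟨i, n⟩, hi, fun y s h => ?_⟩
  change dist (c i) y + 1 / ((n : ℝ) + 1) < s
  have := dist_triangle (c i) x y
  rw [dist_comm (c i) x] at this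
  linarith

/-- The filter of the formal balls containing `x`. -/
noncomputable def pointFilter (hc : DenseRange c) (x : X) : Order.PFilter (FormalBall c) :=
  Order.IsPFilter.toPFilter (F := {p | x ∈ p.ball}) <| by
    refine Order.IsPFilter.of_def ?_ ?_ ?_
    · obtain ⟨r, hr, -⟩ := exists_inside hc x one_pos
      exact ⟨r, hr⟩
    · intro p hp q hq
      have hp' := mem_ball.1 hp
      have hq' := mem_ball.1 hq
      obtain ⟨r, hr, h⟩ := exists_inside hc x
        (lt_min (sub_pos.2 hp') (sub_pos.2 hq'))
      refine ⟨r, hr, Or.inr (h _ _ ?_), Or.inr (h _ _ ?_)⟩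
      · linarith [min_le_left (p.radius - dist x p.center) (q.radius - dist x q.center)]
      · linarith [min_le_right (p.radius - dist x p.center) (q.radius - dist x q.center)]
    · exact fun h hp => ball_mono h hp

theorem isTopologicalBasis_ball (hc : DenseRange c) :
    IsTopologicalBasis (range fun p : FormalBall c => p.ball) := by
  refine isTopologicalBasis_of_isOpen_of_nhds ?_ fun x U hx hU => ?_
  · rintro _ ⟨p, rfl⟩
    exact Metric.isOpen_ball
  · obtain ⟨ε, hε, hball⟩ := Metric.isOpen_iff.1 hU x hx
    obtain ⟨r, hr, h⟩ := exists_inside hc x hε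
    refine ⟨_, ⟨r, rfl⟩, hr, fun y hy => hball ?_⟩
    have h1 := h x ε (by simp)
    have h2 := dist_triangle y r.center x
    have h3 := mem_ball.1 hy
    rw [Metric.mem_ball]
    linarith

theorem eq_of_pointFilter_le (hc : DenseRange c) {x y : X}
    (h : pointFilter hc x ≤ pointFilter hc y) : x = y := by
  refine Inseparable.eq (specializes_iff_inseparable.1 ?_) |>.symm
  refine (isTopologicalBasis_ball hc).nhds_hasBasis.ge_iff.2 ?_
  rintro _ ⟨⟨p, rfl⟩, hp⟩
  exact Metric.isOpen_ball.mem_nhds (h hp)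

/-- In a complete space every filter of formal balls is contained in the filter of a point. -/
theorem exists_le_pointFilter [CompleteSpace X] [Countable ι] (hc : DenseRange c)
    (F : Order.PFilter (FormalBall c)) : ∃ x, F ≤ pointFilter hc x := by
  -- Such a `p` is by directedness the least element of `F`, so its centre lies in all balls of `F`.
  by_cases hmin : ∃ p ∈ F, ∀ q ∈ F, ¬ q.Inside p
  · obtain ⟨p, hp, hpm⟩ := hmin
    refine ⟨p.center, fun q hq => ?_⟩
    obtain ⟨r, hr, hrp, hrq⟩ := F.directed p hp q hq
    rcases le_iff.1 hrp with rfl | h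
    · exact ball_mono hrq (Metric.mem_ball_self r.radius_pos)
    · exact absurd h (hpm r hr)
  · push Not at hmin
    obtain ⟨p₀, hp₀⟩ := F.nonempty
    have : Nonempty F := ⟨⟨p₀, hp₀⟩⟩
    obtain ⟨e, he⟩ := exists_surjective_nat F
    have hnext : ∀ p q : F, ∃ r : F, r.1.Inside p.1 ∧ r.1 ≤ q.1 := by
      intro p q
      obtain ⟨s, hs, hsp⟩ := hmin p.1 p.2
      obtain ⟨r, hr, hrs, hrq⟩ := F.directed s hs q.1 q.2
      refine ⟨⟨r, hr⟩, ?_, hrq⟩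
      rcases le_iff.1 hrs with rfl | h
      exacts [hsp, h.trans hsp]
    choose nxt hin hle using hnext
    -- A strictly descending sequence that passes below every element of the countable filter `F`.
    let a : ℕ → F := fun n => n.rec ⟨p₀, hp₀⟩ fun k b => nxt b (e k)
    have hstep : ∀ n, (a (n + 1)).1.Inside (a n).1 := fun n => hin _ _
    have hea : ∀ n, (a (n + 1)).1 ≤ (e n).1 := fun n => hle _ _
    have hlt : ∀ n k, (a (n + k + 1)).1.Inside (a n).1 := by
      intro n k
      induction k with
      | zero => exact hstep n
      | succ k ih => exact (hstep (n + k + 1)).trans ih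
    have hmem : ∀ n m, n ≤ m → (a m).1.center ∈ Metric.closedBall (a n).1.center (a n).1.radius := by
      intro n m hnm
      rcases hnm.eq_or_lt with rfl | h
      · exact Metric.mem_closedBall_self (radius_pos _).le
      · obtain ⟨k, rfl⟩ := Nat.exists_eq_add_of_lt h
        have h1 : dist _ _ + _ < _ := hlt n k
        have h2 := (a (n + k + 1)).1.radius_pos
        rw [Metric.mem_closedBall]
        linarith
    -- The drops in radius telescope to at most the first radius, so the centres form a Cauchy
    -- sequence.
    have hdist : ∀ n, dist (a n).1.center (a (n + 1)).1.center ≤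
        (a n).1.radius - (a (n + 1)).1.radius := by
      intro n
      have : dist _ _ + _ < _ := hstep n
      rw [dist_comm]
      linarith
    have hsum : Summable fun n => (a n).1.radius - (a (n + 1)).1.radius := by
      refine summable_of_sum_range_le (c := (a 0).1.radius)
        (fun n => sub_nonneg.2 (hstep n).radius_lt.le) fun n => ?_
      rw [Finset.sum_range_sub']
      linarith [(a n).1.radius_pos]
    obtain ⟨x, hx⟩ := cauchySeq_tendsto_of_complete
      (cauchySeq_of_dist_le_of_summable _ hdist hsum)
    have hxa : ∀ n, x ∈ (a n).1.ball := fun n => (hstep n).mem_ball <|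
      Metric.isClosed_closedBall.mem_of_tendsto hx
        (Filter.eventually_atTop.2 ⟨n + 1, fun m hm => hmem (n + 1) m hm⟩)
    refine ⟨x, fun q hq => ?_⟩
    obtain ⟨n, hn⟩ := he ⟨q, hq⟩
    have h := hea n
    rw [hn] at h
    exact ball_mono h (hxa (n + 1))

variable [CompleteSpace X] [Countable ι]

theorem isMax_pointFilter (hc : DenseRange c) (x : X) : IsMax (pointFilter hc x) := by
  intro G hG
  obtain ⟨y, hy⟩ := exists_le_pointFilter hc G
  rwa [eq_of_pointFilter_le hc (hG.trans hy)]

/-- A complete separable metric space is the maximal filter space of its formal balls. -/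
theorem nonempty_homeomorph (hc : DenseRange c) :
    Nonempty (X ≃ₜ MaximalFilter (FormalBall c)) := by
  let f : X → MaximalFilter (FormalBall c) := fun x => ⟨pointFilter hc x, isMax_pointFilter hc x⟩
  have hbij : Function.Bijective f := by
    refine ⟨fun x y h => eq_of_pointFilter_le hc (Subtype.ext_iff.1 h).le, fun F => ?_⟩
    obtain ⟨x, hx⟩ := exists_le_pointFilter hc F.1
    exact ⟨x, Subtype.ext ((F.2 hx).antisymm hx)⟩
  have hind : Topology.IsInducing f := by
    refine ⟨?_⟩
    rw [(isTopologicalBasis_ball hc).eq_generateFrom, instTopologicalSpaceMaximalFilter,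
      induced_generateFrom_eq, ← range_comp]
    rfl
  exact ⟨(Equiv.ofBijective f hbij).toHomeomorphOfIsInducing hind⟩

end FormalBall

theorem isCountablyBasedMaximalFilterSpace_of_isCompletelyMetrizableSpace (X : Type u)
    [TopologicalSpace X] [Countable X] [IsCompletelyMetrizableSpace X] :
    IsCountablyBasedMaximalFilterSpace.{u, v} X := by
  let _ := upgradeIsCompletelyMetrizable X
  -- Every point of `X` serves as a centre; indexing by a copy of `X` in universe `v` puts the poset
  -- there.
  obtain ⟨S, ⟨e⟩⟩ := (inferInstance : Small.{v} X).equiv_small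
  have : Countable S := e.symm.injective.countable
  exact ⟨FormalBall e.symm, inferInstance, inferInstance,
    FormalBall.nonempty_homeomorph e.symm.surjective.denseRange⟩

end FormalBalls

theorem mainTheorem9 (L : Type u) [LinearOrder L] [Countable L]
    [TopologicalSpace L] [OrderTopology L] :
    List.TFAE
      [orderRK L < ⊤,
       IsStrongChoquet L,
       IsMaximalFilterSpace.{u, v} L,
       IsCountablyBasedMaximalFilterSpace.{u, v} L,
       IsCompletelyMetrizableSpace L] := by
  tfae_have 1 → 5 := isCompletelyMetrizableSpace_of_orderRK_lt_top L
  tfae_have 5 → 4 := fun _ => isCountablyBasedMaximalFilterSpace_of_isCompletelyMetrizableSpace L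
  tfae_have 4 → 3 := fun ⟨P, hP, _, h⟩ => ⟨P, hP, h⟩
  tfae_have 3 → 2 := fun ⟨P, _, ⟨e⟩⟩ => (MaximalFilter.isStrongChoquet P).of_homeomorph e
  tfae_have 2 → 1 := fun h => orderRK_lt_top_of_preperfect fun _ hK => h.eq_empty_of_preperfect hK
  tfae_finish
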